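/- Let $V$ be a finite set of criteria; let each $\gamma\in V$ have a finite set $\mathcal I_\gamma$ of levels, with a fixed base level $i^*_\gamma\in\mathcal I_\gamma$; put $\mathcal I=\prod_{\gamma\in V}\mathcal I_\gamma$ (the cells). For $E\subseteq V$ let $\mathcal I_E^*=\{(i_\gamma)_{\gamma\in E} : i_\gamma\in\mathcal I_\gamma,\ i_\gamma\neq i_\gamma^*\ \forall\gamma\in E\}$ (a single point if $E=\emptyset$); for $i_E\in\mathcal I_E^*$ and $F\subseteq E$ let $i_F$ be the restriction of $i_E$ to $F$, and let $i(E)=(i_E,i^*_{E^c})\in\mathcal I$. Let $\mathcal A$ be a class of subsets of $V$ and $\mathcal D=\{E\neq\emptyset : E\subseteq A\text{ for some }A\in\mathcal A\}$. Let $d_{\mathcal D}=\sum_{D\in\mathcal D}|\mathcal I_D^*|$ and assume $d_{\mathcal D}\ge 1$. Vectors in $\mathbb R^{d_{\mathcal D}}$ are indexed by the pairs $(D,i_D)$ with $D\in\mathcal D$, $i_D\in\mathcal I_D^*$. For $\theta\in\mathbb R^{d_{\mathcal D}}$ put $$Z(\theta)=1+\sum_{\emptyset\ne E\subseteq V}\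 \sum_{i_E\in\mathcal I_E^*}\exp\sum_{F\subseteq E,\,F\in\mathcal D}\theta(i_F).$$ For $s\in\mathbb R^{d_{\mathcal D}}$ and $\alpha\in\mathbb R$, the Diaconis–Ylvisaker conjugate prior with hyperparameters $(s,\alpha)$ has density with respect to Lebesgue measure on $\mathbb R^{d_{\mathcal D}}$ equal to $$I_{\mathcal D}(s,\alpha)^{-1}\exp\Big\{\sum_{D\in\mathcal D}\sum_{i_D\in\mathcal I_D^*}\theta(i_D)s(i_D)-\alpha\log Z(\theta)\Big\},$$ where $I_{\mathcal D}(s,\alpha)\in(0,\infty]$ is the integral of the exponential over $\mathbb R^{d_{\mathcal D}}$; the prior is called proper if $I_{\mathcal D}(s,\alpha)<\infty$. The hierarchical log-linear model generated by $\mathcal A$ is the set of tables $p:\mathcal I\to(0,\infty)$ with $\sum_{j}p(j)=1$ and $$\sum_{F\subseteq E}(-1)^{|E\setminus F|}\log p(i_F,i^*_{F^c})=0\qquad\text{for all nonempty }E\notin\mathcal D,\ i_E\in\mathcal I_E^*.$$ The $\mathcal D$-marginal cell probability space is the set of all vectors $\big(\sum_{j\in\mathcal I,\,j_D=i_D}p(j)\big)_{D\in\mathcal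 D,\,i_D\in\mathcal I_D^*}$ with $p$ in this model. **Lemma 3.1.** For all $s\in\mathbb R^{d_{\mathcal D}}$ and $\alpha\in\mathbb R$, the following are equivalent: 1. the prior with hyperparameters $(s,\alpha)$ is proper; 2. $\alpha>0$ and $s/\alpha$ belongs to the $\mathcal D$-marginal cell probability space; 3. $\alpha>0$ and there are real numbers $\rho(j)>0$, $j\in\mathcal I$, such that $$s(i_D)=\alpha\sum_{j\in\mathcal I,\;j_D=i_D}\rho(j)\qquad\text{for all }D\in\mathcal D,\ i_D\in\mathcal I_D^*,$$ and, for some $\theta\in\mathbb R^{d_{\mathcal D}}$, $$\rho(i(E))=\frac{\exp\sum_{F\subseteq E,\,F\in\mathcal D}\theta(i_F)}{Z(\theta)}\qquad\text{for all }E\subseteq V,\ i_E\in\mathcal I_E^*.$$ -/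

import Mathlib

open MeasureTheory

/-! Contingency tables. `V` is the finite set of criteria, `I γ` the finite set of levels of the
criterion `γ`, a cell is an element of `∀ γ, I γ`, and `b : ∀ γ, I γ` is the fixed base cell
(all criteria at their lowest level, written `i^*` in the literature). -/

namespace LogLinear

/-- The marginal cells `i_E` that have no component at the base level. -/
abbrev StarCell {V : Type*} {I : V → Type*} (b : ∀ γ, I γ) (E : Finset V) : Type _ :=
  {i : ∀ γ : E, I γ // ∀ γ : E, i γ ≠ b γ}

/-- The marginal cell `i_F` of `i_E`, for `F ⊆ E`. -/
def StarCell.restrict {V : Type*} {I : V → Type*} {b : ∀ γ, I γ} {E F : Finset V}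
    (h : F ⊆ E) (i : StarCell b E) : StarCell b F :=
  ⟨fun γ => i.1 ⟨γ.1, h γ.2⟩, fun γ => i.2 ⟨γ.1, h γ.2⟩⟩

/-- The cell `i(E) = (i_E, i^*_{E^c})`. -/
def StarCell.toCell {V : Type*} [DecidableEq V] {I : V → Type*} {b : ∀ γ, I γ} {E : Finset V}
    (i : StarCell b E) : ∀ γ, I γ :=
  fun γ => if h : γ ∈ E then i.1 ⟨γ, h⟩ else b γ

/-- All interactions (main effects included) of the hierarchical model with generating class `A`:
the nonempty subsets of the members of `A`. -/
def interactions {V : Type*} [Fintype V] [DecidableEq V] (A : Finset (Finset V)) :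
    Finset (Finset V) :=
  Finset.univ.filter fun E => E.Nonempty ∧ ∃ G ∈ A, E ⊆ G

/-- The index set of the free log-linear parameters:
the pairs `(D, i_D)` with `D ∈ 𝒟` and `i_D ∈ I_D^*`. -/
abbrev Index {V : Type*} {I : V → Type*} (b : ∀ γ, I γ) (𝒟 : Finset (Finset V)) : Type _ :=
  Σ D : {D : Finset V // D ∈ 𝒟}, StarCell b D.1

/-- `∑_{F ⊆ E, F ∈ 𝒟} θ(i_F)`. -/
def predictor {V : Type*} [Fintype V] [DecidableEq V] {I : V → Type*} {b : ∀ γ, I γ}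
    {𝒟 : Finset (Finset V)} (θ : Index b 𝒟 → ℝ) {E : Finset V} (i : StarCell b E) : ℝ :=
  ∑ F : {F : Finset V // F ∈ 𝒟 ∧ F ⊆ E}, θ ⟨⟨F.1, F.2.1⟩, i.restrict F.2.2⟩

/-- `1 + ∑_{E ≠ ∅} ∑_{i_E ∈ I_E^*} exp ∑_{F ⊆ E, F ∈ 𝒟} θ(i_F)`. -/
noncomputable def partitionFn {V : Type*} [Fintype V] [DecidableEq V] {I : V → Type*}
    [∀ γ, Fintype (I γ)] [∀ γ, DecidableEq (I γ)] {b : ∀ γ, I γ}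
    {𝒟 : Finset (Finset V)} (θ : Index b 𝒟 → ℝ) : ℝ :=
  1 + ∑ E : {E : Finset V // E.Nonempty}, ∑ i : StarCell b E.1, Real.exp (predictor θ i)

/-- The Diaconis–Ylvisaker conjugate prior density with hyperparameters `(s, α)`, with respect to
the Lebesgue measure and without its normalising constant. -/
noncomputable def priorKernel {V : Type*} [Fintype V] [DecidableEq V] {I : V → Type*}
    [∀ γ, Fintype (I γ)] [∀ γ, DecidableEq (I γ)] {b : ∀ γ, I γ}
    {𝒟 : Finset (Finset V)} (s : Index b 𝒟 → ℝ) (α : ℝ) (θ : Index b 𝒟 → ℝ) : ℝ :=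
  Real.exp (∑ x, θ x * s x - α * Real.log (partitionFn θ))

/-- The normalising constant, with values in `[0, ∞]`. -/
noncomputable def normConst {V : Type*} [Fintype V] [DecidableEq V] {I : V → Type*}
    [∀ γ, Fintype (I γ)] [∀ γ, DecidableEq (I γ)] {b : ∀ γ, I γ}
    {𝒟 : Finset (Finset V)} (s : Index b 𝒟 → ℝ) (α : ℝ) : ENNReal :=
  ∫⁻ θ : Index b 𝒟 → ℝ, ENNReal.ofReal (priorKernel s α θ)

/-- The prior is proper if its normalising constant is finite. -/
def IsProper {V : Type*} [Fintype V] [DecidableEq V] {I : V → Type*}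
    [∀ γ, Fintype (I γ)] [∀ γ, DecidableEq (I γ)] {b : ∀ γ, I γ}
    {𝒟 : Finset (Finset V)} (s : Index b 𝒟 → ℝ) (α : ℝ) : Prop :=
  normConst s α < ⊤

/-- The marginal sum `∑_{j : j_D = i_D} p(j)`. -/
def marginal {V : Type*} [Fintype V] [DecidableEq V] {I : V → Type*}
    [∀ γ, Fintype (I γ)] [∀ γ, DecidableEq (I γ)] {b : ∀ γ, I γ}
    (p : (∀ γ, I γ) → ℝ) {D : Finset V} (i : StarCell b D) : ℝ :=
  ∑ j : ∀ γ, I γ with (∀ γ : D, j γ = i.1 γ), p j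

/-- The log-linear (corner constraint) parameter
`θ_E(i_E) = ∑_{F ⊆ E} (-1)^{|E \ F|} log p(i_F, i^*_{F^c})` of a table `p`. -/
noncomputable def logLinearParam {V : Type*} [Fintype V] [DecidableEq V] {I : V → Type*}
    {b : ∀ γ, I γ} (p : (∀ γ, I γ) → ℝ) {E : Finset V} (i : StarCell b E) : ℝ :=
  ∑ F : {F : Finset V // F ⊆ E},
    (-1) ^ (E \ F.1).card * Real.log (p (i.restrict F.2).toCell)

/-- The hierarchical log-linear model with set of interactions `𝒟`: the strictly positive
probability tables whose parameters `θ(i_E)` vanish for all nonempty `E ∉ 𝒟`. -/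
def hierarchicalModel {V : Type*} [Fintype V] [DecidableEq V] {I : V → Type*}
    [∀ γ, Fintype (I γ)] (b : ∀ γ, I γ) (𝒟 : Finset (Finset V)) :
    Set ((∀ γ, I γ) → ℝ) :=
  {p | (∀ j, 0 < p j) ∧ ∑ j, p j = 1 ∧
    ∀ E : Finset V, E.Nonempty → E ∉ 𝒟 → ∀ i : StarCell b E, logLinearParam p i = 0}

/-- The `𝒟`-marginal cell probability space: the vectors of marginal probabilities
`p(i_D)`, `D ∈ 𝒟`, `i_D ∈ I_D^*`, of the tables in the hierarchical log-linear model. -/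
def marginalSpace {V : Type*} [Fintype V] [DecidableEq V] {I : V → Type*}
    [∀ γ, Fintype (I γ)] [∀ γ, DecidableEq (I γ)] (b : ∀ γ, I γ) (𝒟 : Finset (Finset V)) :
    Set (Index b 𝒟 → ℝ) :=
  {m | ∃ p ∈ hierarchicalModel b 𝒟, ∀ x : Index b 𝒟, m x = marginal p x.2}

end LogLinear

/-! Coded by agreement indicators, the model is an exponential family: Z(θ) = ∑_j exp l_j, where l_j
= ⟨θ, a_j⟩ and l_j = 0 at the base cell. (1) ⇒ (3): Z ≥ 1, so α ≤ 0 would keep the kernel at least 1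
on a half-space of infinite volume. For α > 0 the kernel is h^(-α) with h(θ) = Z(θ) exp(-⟨θ, s⟩/α)
convex. By Markov's inequality a sublevel set of h has finite volume, so it is bounded by convexity
(`Convex.isBounded_of_measure_lt_top`). Hence h has a minimiser, where the vanishing gradient says
that s/α is the mean of the a_j. (3) ⇒ (2): Möbius inversion of the log-probabilities kills every
interaction outside 𝒟. (2) ⇒ (1): for a positive p with margins s/α, the gap between max l and the
p-mean of l controls all |l_j|, hence ∑ |θ x|, because the predictors determine θ linearly. The
kernel is therefore dominated by a product of two-sided exponentials. -/

/-- A convex set of finite volume with nonempty interior is bounded. -/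
theorem Convex.isBounded_of_measure_lt_top {E : Type*} [NormedAddCommGroup E] [NormedSpace ℝ E]
    [MeasurableSpace E] [BorelSpace E] (μ : Measure E) [μ.IsAddHaarMeasure] {S : Set E}
    (hS : Convex ℝ S) (hne : (interior S).Nonempty) (hμ : μ S < ⊤) :
    Bornology.IsBounded S := by
  obtain ⟨x₀, hx₀⟩ := hne
  obtain ⟨r, hr, hball⟩ := Metric.mem_nhds_iff.1 (mem_interior_iff_mem_nhds.1 hx₀)
  by_contra hunb
  have hv : 0 < μ (Metric.ball (0 : E) (r / 2)) := Metric.measure_ball_pos μ _ (by positivity)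
  -- Pack n disjoint balls of radius r/2, with centres r apart, along the segment from x₀ towards a
  -- distant y in S.
  have key : ∀ n : ℕ, (n : ENNReal) * μ (Metric.ball (0 : E) (r / 2)) ≤ μ S := by
    intro n
    obtain ⟨y, hyS, hy⟩ : ∃ y ∈ S, 2 * r * (n + 1) < ‖y - x₀‖ := by
      by_contra! h
      exact hunb ((Metric.isBounded_closedBall (x := x₀) (r := 2 * r * (n + 1))).subset
        fun y hy => by simpa [dist_eq_norm] using h y hy)
    have hN : 0 < ‖y - x₀‖ := lt_trans (by positivity) hy
    set t : ℕ → ℝ := fun k => k * r / ‖y - x₀‖ with ht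
    set c : ℕ → E := fun k => x₀ + t k • (y - x₀) with hc
    have hdisj : Set.PairwiseDisjoint (↑(Finset.range n))
        fun k => Metric.ball (c k) (r / 2) := by
      intro k _ l _ hkl
      apply Metric.ball_disjoint_ball
      have h1 : c k - c l = (((k : ℝ) - l) * (r / ‖y - x₀‖)) • (y - x₀) := by
        simp only [hc, ht]
        rw [add_sub_add_left_eq_sub, ← sub_smul]
        congr 1
        ring
      have h2 : (1 : ℝ) ≤ |(k : ℝ) - l| := by
        have : (1 : ℤ) ≤ |(k : ℤ) - l| := Int.one_le_abs (by omega)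
        exact_mod_cast this
      rw [dist_eq_norm, h1, norm_smul, Real.norm_eq_abs, abs_mul, abs_of_pos (div_pos hr hN),
        mul_assoc, div_mul_cancel₀ _ hN.ne']
      nlinarith
    have hsub : (⋃ k ∈ Finset.range n, Metric.ball (c k) (r / 2)) ⊆ S := by
      intro z hz
      simp only [Set.mem_iUnion, Finset.mem_range] at hz
      obtain ⟨k, hk, hz⟩ := hz
      have hk' : (k : ℝ) < n := by exact_mod_cast hk
      have ht0 : 0 ≤ t k := by positivity
      -- All centres lie in the first half of the segment, where the cone over the r-ball with apex
      -- y still has radius at least r/2.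
      have ht1 : t k ≤ 1 / 2 := by
        simp only [ht]
        rw [div_le_iff₀ hN]
        nlinarith
      have hpos : 0 < 1 - t k := by linarith
      -- Undoing the contraction towards y sends z back into the r-ball; z is then a convex
      -- combination of this point and y.
      have hw : x₀ + (1 - t k)⁻¹ • (z - c k) ∈ S := by
        apply hball
        rw [Metric.mem_ball, dist_eq_norm, add_sub_cancel_left, norm_smul, Real.norm_eq_abs,
          abs_of_pos (inv_pos.2 hpos), inv_mul_lt_iff₀ hpos]
        rw [Metric.mem_ball, dist_eq_norm] at hz
        nlinarith
      have := hS hw hyS hpos.le ht0 (by ring)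
      convert this using 1
      rw [smul_add, smul_smul, mul_inv_cancel₀ hpos.ne', one_smul]
      simp only [hc, sub_smul, smul_sub, one_smul]
      abel
    calc (n : ENNReal) * μ (Metric.ball (0 : E) (r / 2))
        = ∑ k ∈ Finset.range n, μ (Metric.ball (c k) (r / 2)) := by
          simp [Measure.addHaar_ball_center]
      _ = μ (⋃ k ∈ Finset.range n, Metric.ball (c k) (r / 2)) :=
          (measure_biUnion_finset hdisj fun _ _ => measurableSet_ball).symm
      _ ≤ μ S := measure_mono hsub
  have htop : μ S / μ (Metric.ball (0 : E) (r / 2)) < ⊤ := ENNReal.div_lt_top hμ.ne hv.ne'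
  obtain ⟨n, hn⟩ := ENNReal.exists_nat_gt htop.ne
  refine absurd (key n) (not_le.2 ?_)
  -- Finite dimension is not assumed, so an infinite ball measure is excluded through n = 1.
  by_cases hfin : μ (Metric.ball (0 : E) (r / 2)) = ⊤
  · exact absurd hμ (not_lt.2 (by simpa [hfin] using key 1))
  · exact (ENNReal.div_lt_iff (Or.inl hv.ne') (Or.inl hfin)).1 hn

/-- Half-spaces, degenerate ones included, have infinite volume. -/
theorem volume_setOf_sum_mul_nonneg {X : Type*} [Fintype X] [Nonempty X] (s : X → ℝ) :
    volume {θ : X → ℝ | 0 ≤ ∑ x, θ x * s x} = ⊤ := by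
  set H := {θ : X → ℝ | 0 ≤ ∑ x, θ x * s x} with hH
  -- H and -H have equal volume and cover a space of infinite volume.
  have hneg : volume (-H) = volume H := Measure.measure_neg _ _
  have huniv : H ∪ -H = Set.univ := by
    ext θ
    simp only [hH, Set.mem_union, Set.mem_neg, Set.mem_ofPred_eq, Pi.neg_apply, neg_mul,
      Finset.sum_neg_distrib, Set.mem_univ, iff_true]
    rcases le_total 0 (∑ x, θ x * s x) with h | h
    · exact Or.inl h
    · exact Or.inr (by linarith)
  have h1 : (volume (Set.univ : Set (X → ℝ))) ≤ volume H + volume (-H) :=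
    huniv ▸ measure_union_le _ _
  rw [hneg, measure_univ_of_isAddLeftInvariant, top_le_iff, ENNReal.add_eq_top] at h1
  exact h1.elim id id

/-! ### Properness and means in a finite exponential family -/

namespace LogLinear

section ExponentialFamily

variable {J X : Type*} [Fintype J] [Fintype X]

/-- The mean of the conjugate prior's exponential family is attained: properness forces `0 < α`
and `s / α` to be a mean value of the exponential family with sufficient statistic `a`. -/
theorem exists_mean_eq_of_lintegral_lt_top [Nonempty X] (a : J → X → ℝ) (j₀ : J)
    (ha₀ : a j₀ = 0) (s : X → ℝ) (α : ℝ)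
    (hfin : ∫⁻ θ : X → ℝ, ENNReal.ofReal (Real.exp (∑ x, θ x * s x -
      α * Real.log (∑ j, Real.exp (∑ x, θ x * a j x)))) < ⊤) :
    0 < α ∧ ∃ θ : X → ℝ, ∀ x, s x = α * ∑ j, Real.exp (∑ y, θ y * a j y) /
      (∑ k, Real.exp (∑ y, θ y * a k y)) * a j x := by
  have : Nonempty J := ⟨j₀⟩
  have hZ1 : ∀ θ : X → ℝ, 1 ≤ ∑ j, Real.exp (∑ x, θ x * a j x) := fun θ => by
    have := Finset.single_le_sum (f := fun j => Real.exp (∑ x, θ x * a j x))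
      (fun j _ => (Real.exp_pos _).le) (Finset.mem_univ j₀)
    simpa [ha₀] using this
  have hcont : Continuous fun θ : X → ℝ => ENNReal.ofReal (Real.exp (∑ x, θ x * s x -
      α * Real.log (∑ j, Real.exp (∑ x, θ x * a j x)))) := by
    refine ENNReal.continuous_ofReal.comp (Real.continuous_exp.comp (Continuous.sub (by fun_prop)
      (continuous_const.mul (Continuous.log (by fun_prop) fun θ => ?_))))
    exact (lt_of_lt_of_le one_pos (hZ1 θ)).ne'
  have hmarkov : ∀ (ε : ℝ), 0 < ε → ∀ S : Set (X → ℝ), (∀ θ ∈ S, ε ≤ Real.exp (∑ x, θ x * s x -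
      α * Real.log (∑ j, Real.exp (∑ x, θ x * a j x)))) → volume S < ⊤ := by
    intro ε hε S hS
    have hε' : ENNReal.ofReal ε ≠ 0 := by simpa using hε
    refine lt_of_le_of_lt ((measure_mono fun θ hθ => ?_).trans
      (meas_ge_le_lintegral_div hcont.measurable.aemeasurable hε' ENNReal.ofReal_ne_top))
      (ENNReal.div_lt_top hfin.ne hε')
    exact ENNReal.ofReal_le_ofReal (hS θ hθ)
  have hα : 0 < α := by
    by_contra! hα
    refine absurd (hmarkov 1 one_pos {θ | 0 ≤ ∑ x, θ x * s x} fun θ hθ => ?_)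
      (by rw [volume_setOf_sum_mul_nonneg]; exact lt_irrefl _)
    rw [Real.one_le_exp_iff]
    have h1 : 0 ≤ Real.log (∑ j, Real.exp (∑ x, θ x * a j x)) := Real.log_nonneg (hZ1 θ)
    have h2 : 0 ≤ ∑ x, θ x * s x := hθ
    nlinarith
  refine ⟨hα, ?_⟩
  set h : (X → ℝ) → ℝ := fun θ => ∑ j, Real.exp (∑ x, θ x * (a j x - s x / α)) with hh
  have hhc : Continuous h := by fun_prop
  have hhpos : ∀ θ, 0 < h θ := fun θ =>
    Finset.sum_pos (fun j _ => Real.exp_pos _) Finset.univ_nonempty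
  have hsplit : ∀ (θ : X → ℝ) (j : J), ∑ x, θ x * (a j x - s x / α) =
      ∑ x, θ x * a j x - (∑ x, θ x * s x) / α := by
    intro θ j
    rw [Finset.sum_div, ← Finset.sum_sub_distrib]
    exact Finset.sum_congr rfl fun x _ => by ring
  have hhZ : ∀ θ, h θ = (∑ j, Real.exp (∑ x, θ x * a j x)) *
      Real.exp (-((∑ x, θ x * s x) / α)) := by
    intro θ
    simp only [hh, Finset.sum_mul]
    exact Finset.sum_congr rfl fun j _ => by rw [hsplit, sub_eq_add_neg, Real.exp_add]
  have hker : ∀ θ, ∑ x, θ x * s x - α * Real.log (∑ j, Real.exp (∑ x, θ x * a j x)) =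
      -(α * Real.log (h θ)) := by
    intro θ
    rw [hhZ, Real.log_mul (lt_of_lt_of_le one_pos (hZ1 θ)).ne' (Real.exp_pos _).ne', Real.log_exp]
    field_simp
    ring
  have hconv : ConvexOn ℝ Set.univ h := by
    have : h = ∑ j, fun θ : X → ℝ => Real.exp (∑ x, θ x * (a j x - s x / α)) := by
      ext θ; simp [hh]
    rw [this]
    refine Finset.sum_induction _ (ConvexOn ℝ Set.univ) (fun _ _ => ConvexOn.add)
      (convexOn_const 0 convex_univ) fun j _ => ?_
    have := convexOn_exp.comp_linearMap
      (∑ x, (a j x - s x / α) • (LinearMap.proj x : (X → ℝ) →ₗ[ℝ] ℝ))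
    rw [Set.preimage_univ] at this
    refine this.congr fun θ _ => ?_
    simp [mul_comm]
  -- The slack 1 puts 0 in the interior; on S the kernel is bounded below, so S has finite volume.
  set S : Set (X → ℝ) := {θ | h θ ≤ h 0 + 1} with hSdef
  have hSconv : Convex ℝ S := by simpa [hSdef] using hconv.convex_le (h 0 + 1)
  have hSfin : volume S < ⊤ := by
    refine hmarkov (Real.exp (-(α * Real.log (h 0 + 1)))) (Real.exp_pos _) S fun θ hθ => ?_
    rw [hker, Real.exp_le_exp, neg_le_neg_iff]
    exact mul_le_mul_of_nonneg_left (Real.log_le_log (hhpos θ) hθ) hα.le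
  have hSint : (interior S).Nonempty :=
    ⟨0, mem_interior_iff_mem_nhds.2 (Filter.mem_of_superset
      (hhc.continuousAt.eventually (gt_mem_nhds (lt_add_one (h 0)))) fun θ hθ => (show h θ < h 0 + 1 from hθ).le)⟩
  have hScomp : IsCompact S := Metric.isCompact_of_isClosed_isBounded
    (isClosed_le hhc continuous_const) (hSconv.isBounded_of_measure_lt_top volume hSint hSfin)
  have h0S : (0 : X → ℝ) ∈ S := by simp [hSdef]
  obtain ⟨θ, hθS, hθ⟩ := hScomp.exists_isMinOn ⟨0, h0S⟩ hhc.continuousOn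
  have hmin : ∀ θ', h θ ≤ h θ' := by
    intro θ'
    by_cases hmem : θ' ∈ S
    · exact hθ hmem
    · have := hθ h0S
      simp only [hSdef, Set.mem_ofPred_eq, not_le] at hmem this
      linarith
  refine ⟨θ, fun x => ?_⟩
  classical
  have hder : HasDerivAt (fun t : ℝ => h (θ + t • Pi.single x 1))
      (∑ j, Real.exp (∑ y, θ y * (a j y - s y / α)) * (a j x - s x / α)) 0 := by
    have hlin : ∀ t : ℝ, ∀ j, ∑ y, (θ + t • (Pi.single x 1 : X → ℝ)) y * (a j y - s y / α) =
        ∑ y, θ y * (a j y - s y / α) + t * (a j x - s x / α) := by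
      intro t j
      simp [add_mul, Finset.sum_add_distrib, Pi.single_apply]
    simp only [hh, hlin]
    refine HasDerivAt.fun_sum fun j _ => ?_
    have := (((hasDerivAt_id (0 : ℝ)).mul_const (a j x - s x / α)).const_add
      (∑ y, θ y * (a j y - s y / α))).exp
    simpa using this
  have hzero := IsLocalMin.hasDerivAt_eq_zero (Filter.Eventually.of_forall fun t => by
    simpa using hmin (θ + t • Pi.single x 1)) hder
  have hZpos := lt_of_lt_of_le one_pos (hZ1 θ)
  set Z := ∑ k, Real.exp (∑ y, θ y * a k y) with hZ
  have h3 : ∑ j, Real.exp (∑ y, θ y * a j y) * (a j x - s x / α) = 0 := by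
    have he := (Real.exp_pos (-((∑ x, θ x * s x) / α))).ne'
    refine (mul_eq_zero.1 (?_ : _ * Real.exp (-((∑ x, θ x * s x) / α)) = 0)).resolve_right he
    rw [← hzero, Finset.sum_mul]
    refine Finset.sum_congr rfl fun j _ => ?_
    rw [hsplit, sub_eq_add_neg (∑ x, θ x * a j x), Real.exp_add]
    ring
  simp only [mul_sub, Finset.sum_sub_distrib] at h3
  rw [← Finset.sum_mul, ← hZ] at h3
  simp only [div_mul_eq_mul_div]
  rw [← Finset.sum_div, sub_eq_zero.1 h3]
  field_simp

theorem integrable_exp_neg_mul_abs {c : ℝ} (hc : 0 < c) :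
    Integrable fun t : ℝ => Real.exp (-(c * |t|)) := by
  have hneg : -c < 0 := neg_lt_zero.2 hc
  rw [← integrableOn_univ, ← Set.Iic_union_Ioi (a := (0 : ℝ)), integrableOn_union]
  refine ⟨(integrableOn_exp_mul_Iic hc 0).congr_fun (fun t ht => ?_) measurableSet_Iic,
    (integrableOn_exp_mul_Ioi hneg 0).congr_fun (fun t ht => ?_) measurableSet_Ioi⟩
  · simp [abs_of_nonpos (show t ≤ 0 from ht)]
  · simp [abs_of_pos (show 0 < t from ht)]

/-- If `s / α` is a mean of the statistic `a` under a strictly positive probability, and the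
coordinates of `θ` can be recovered from the linear predictors, then the prior is proper. -/
theorem lintegral_lt_top_of_mean_eq (a : J → X → ℝ) (j₀ : J) (ha₀ : a j₀ = 0)
    (hinv : ∀ x, ∃ c : J → ℝ, ∀ θ : X → ℝ, θ x = ∑ j, c j * ∑ y, θ y * a j y)
    (s : X → ℝ) {α : ℝ} (hα : 0 < α) (p : J → ℝ) (hp : ∀ j, 0 < p j) (hp1 : ∑ j, p j = 1)
    (hs : ∀ x, s x = α * ∑ j, p j * a j x) :
    ∫⁻ θ : X → ℝ, ENNReal.ofReal (Real.exp (∑ x, θ x * s x -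
      α * Real.log (∑ j, Real.exp (∑ x, θ x * a j x)))) < ⊤ := by
  have : Nonempty J := ⟨j₀⟩
  obtain ⟨jm, hjm⟩ := Finite.exists_min p
  choose c hc using hinv
  -- C bounds ∑ |θ x| in terms of max |l j|; κ is the resulting decay rate.
  set C := 1 + ∑ x, ∑ j, |c x j| with hC
  have hCpos : 0 < C := by positivity
  set κ := α * p jm / C with hκ
  have hκpos : 0 < κ := by have := hp jm; positivity
  have hprod : Integrable fun θ : X → ℝ => ∏ x, Real.exp (-(κ * |θ x|)) :=
    Integrable.fintype_prod fun _ => integrable_exp_neg_mul_abs hκpos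
  refine lt_of_le_of_lt (lintegral_mono fun θ => ENNReal.ofReal_le_ofReal ?_)
    ((hasFiniteIntegral_iff_ofReal (Filter.Eventually.of_forall fun θ => ?_)).1
      hprod.hasFiniteIntegral)
  swap
  · exact Finset.prod_nonneg fun x _ => (Real.exp_pos _).le
  rw [← Real.exp_sum, Real.exp_le_exp]
  set l : J → ℝ := fun j => ∑ x, θ x * a j x with hl
  have hl0 : l j₀ = 0 := by simp [hl, ha₀]
  obtain ⟨M, hM⟩ := Finite.exists_max l
  have hM0 : 0 ≤ l M := hl0 ▸ hM j₀
  have hlog : l M ≤ Real.log (∑ j, Real.exp (l j)) := by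
    rw [Real.le_log_iff_exp_le (Finset.sum_pos (fun j _ => Real.exp_pos _) Finset.univ_nonempty)]
    exact Finset.single_le_sum (f := fun j => Real.exp (l j)) (fun j _ => (Real.exp_pos _).le)
      (Finset.mem_univ M)
  have hlin : ∑ x, θ x * s x = α * ∑ j, p j * l j := by
    simp only [hs, hl, Finset.mul_sum]
    rw [Finset.sum_comm]
    exact Finset.sum_congr rfl fun j _ => Finset.sum_congr rfl fun x _ => by ring
  have hgap : ∑ j, p j * l j = l M - ∑ j, p j * (l M - l j) := by
    simp only [mul_sub, Finset.sum_sub_distrib]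
    rw [← Finset.sum_mul, hp1]
    ring
  have hterm : ∀ k, p jm * (l M - l k) ≤ ∑ j, p j * (l M - l j) := fun k =>
    (mul_le_mul_of_nonneg_right (hjm k) (sub_nonneg.2 (hM k))).trans
      (Finset.single_le_sum (f := fun j => p j * (l M - l j))
        (fun j _ => mul_nonneg (hp j).le (sub_nonneg.2 (hM j))) (Finset.mem_univ k))
  set G := ∑ j, p j * (l M - l j) with hG
  -- Because l j₀ = 0, a positive l k is at most l M - l j₀, and a negative one satisfies -l k ≤ l M
  -- - l k.
  have habs : ∀ k, p jm * |l k| ≤ G := by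
    intro k
    refine le_trans ?_ (max_le (hterm k) (hterm j₀))
    have := hp jm
    rw [hl0, sub_zero]
    rcases abs_cases (l k) with ⟨h, -⟩ | ⟨h, -⟩ <;> rw [h]
    · exact (mul_le_mul_of_nonneg_left (hM k) this.le).trans (le_max_right _ _)
    · exact (mul_le_mul_of_nonneg_left (by linarith) this.le).trans (le_max_left _ _)
  have hG0 : 0 ≤ G := le_trans (by have := hp jm; positivity) (habs j₀)
  have hsum : p jm * ∑ x, |θ x| ≤ C * G := by
    calc p jm * ∑ x, |θ x| ≤ ∑ x, ∑ j, |c x j| * G := by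
          rw [Finset.mul_sum]
          refine Finset.sum_le_sum fun x _ => ?_
          calc p jm * |θ x| ≤ p jm * ∑ j, |c x j| * |l j| := by
                refine mul_le_mul_of_nonneg_left ?_ (hp jm).le
                rw [hc x θ]
                refine (Finset.abs_sum_le_sum_abs _ _).trans (le_of_eq ?_)
                exact Finset.sum_congr rfl fun j _ => abs_mul _ _
            _ = ∑ j, |c x j| * (p jm * |l j|) := by
                rw [Finset.mul_sum]
                exact Finset.sum_congr rfl fun j _ => by ring
            _ ≤ _ := Finset.sum_le_sum fun j _ =>
                mul_le_mul_of_nonneg_left (habs j) (abs_nonneg _)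
      _ ≤ C * G := by
          simp only [← Finset.sum_mul]
          exact mul_le_mul_of_nonneg_right (by simp [hC]) hG0
  have hfin : ∑ x, κ * |θ x| ≤ α * G := by
    rw [← Finset.mul_sum, hκ, div_mul_eq_mul_div, div_le_iff₀ hCpos]
    nlinarith
  rw [Finset.sum_neg_distrib, hlin, hgap]
  nlinarith

end ExponentialFamily

end LogLinear

/-! ### Möbius inversion -/

/-- Möbius inversion on the lattice of finite subsets. -/
theorem Finset.sum_powerset_neg_one_pow_mul_sum_powerset {V R : Type*} [DecidableEq V] [CommRing R]
    (g : Finset V → R) (E : Finset V) :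
    ∑ F ∈ E.powerset, (-1) ^ (E \ F).card * ∑ G ∈ F.powerset, g G = g E := by
  -- After exchanging sums, g G is weighted by an alternating sum over the interval [G, E], which
  -- vanishes unless G = E.
  have hinner : ∀ G ∈ E.powerset,
      ∑ F ∈ E.powerset with G ⊆ F, (-1 : R) ^ (E \ F).card = if G = E then 1 else 0 := by
    intro G hG
    rw [Finset.mem_powerset] at hG
    have hbij : ∑ F ∈ E.powerset with G ⊆ F, (-1 : R) ^ (E \ F).card =
        ∑ H ∈ (E \ G).powerset, (-1 : R) ^ H.card := by
      refine Finset.sum_nbij' (fun F => E \ F) (fun H => E \ H) ?_ ?_ ?_ ?_ fun _ _ => rfl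
      · intro F hF
        rw [Finset.mem_filter, Finset.mem_powerset] at hF
        exact Finset.mem_powerset.2 (Finset.sdiff_subset_sdiff le_rfl hF.2)
      · intro H hH
        rw [Finset.mem_powerset] at hH
        rw [Finset.mem_filter, Finset.mem_powerset]
        refine ⟨Finset.sdiff_subset, fun γ hγ => Finset.mem_sdiff.2 ⟨hG hγ, fun h => ?_⟩⟩
        exact (Finset.mem_sdiff.1 (hH h)).2 hγ
      · intro F hF
        rw [Finset.mem_filter, Finset.mem_powerset] at hF
        exact Finset.sdiff_sdiff_eq_self hF.1
      · intro H hH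
        rw [Finset.mem_powerset] at hH
        exact Finset.sdiff_sdiff_eq_self (hH.trans Finset.sdiff_subset)
    have hcast := congrArg (Int.cast : ℤ → R)
      (Finset.sum_powerset_neg_one_pow_card (x := E \ G))
    push_cast at hcast
    rw [hbij, hcast]
    refine if_congr ?_ rfl rfl
    rw [Finset.sdiff_eq_empty_iff_subset]
    exact ⟨fun h => hG.antisymm h, fun h => h ▸ le_rfl⟩
  calc ∑ F ∈ E.powerset, (-1) ^ (E \ F).card * ∑ G ∈ F.powerset, g G
      = ∑ F ∈ E.powerset, ∑ G ∈ E.powerset,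
          if G ⊆ F then (-1) ^ (E \ F).card * g G else 0 := by
        refine Finset.sum_congr rfl fun F hF => ?_
        rw [Finset.mem_powerset] at hF
        rw [Finset.mul_sum, ← Finset.sum_filter]
        refine Finset.sum_congr ?_ fun _ _ => rfl
        ext G
        simp only [Finset.mem_powerset, Finset.mem_filter]
        exact ⟨fun h => ⟨h.trans hF, h⟩, fun h => h.2⟩
    _ = ∑ G ∈ E.powerset, (if G = E then 1 else 0) * g G := by
        rw [Finset.sum_comm]
        refine Finset.sum_congr rfl fun G hG => ?_
        rw [← hinner G hG, Finset.sum_mul, Finset.sum_filter]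
    _ = g E := by simp

/-! ### Cells and agreement indicators -/

namespace LogLinear

section Agreement

variable {V : Type*} {I : V → Type*} {b : ∀ γ, I γ} {𝒟 : Finset (Finset V)}
  [∀ γ, DecidableEq (I γ)]

/-- The indicator that the cell `j` has `D`-marginal `i_D`. -/
def agreement (j : ∀ γ, I γ) (x : Index b 𝒟) : ℝ :=
  if ∀ γ : x.1.1, j γ = x.2.1 γ then 1 else 0

/-- A star cell avoids base levels, so the base cell agrees with none over a nonempty D; over ∅
agreement would be vacuous. -/
theorem agreement_base (h𝒟 : ∅ ∉ 𝒟) : (agreement b : Index b 𝒟 → ℝ) = 0 := by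
  ext x
  refine if_neg fun H => ?_
  obtain ⟨γ, hγ⟩ : x.1.1.Nonempty :=
    Finset.nonempty_iff_ne_empty.2 fun h => h𝒟 (h ▸ x.1.2)
  exact x.2.2 ⟨γ, hγ⟩ (H ⟨γ, hγ⟩).symm

end Agreement

section Cells

variable {V : Type*} [DecidableEq V] {I : V → Type*} {b : ∀ γ, I γ}

theorem StarCell.toCell_of_mem {E : Finset V} (i : StarCell b E) {γ : V} (h : γ ∈ E) :
    i.toCell γ = i.1 ⟨γ, h⟩ := dif_pos h

theorem StarCell.toCell_of_notMem {E : Finset V} (i : StarCell b E) {γ : V} (h : γ ∉ E) :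
    i.toCell γ = b γ := dif_neg h

theorem StarCell.mem_iff_toCell_ne {E : Finset V} (i : StarCell b E) (γ : V) :
    γ ∈ E ↔ i.toCell γ ≠ b γ := by
  by_cases h : γ ∈ E
  · simpa [h, i.toCell_of_mem h] using i.2 ⟨γ, h⟩
  · simp [h, i.toCell_of_notMem h]

/-- Off E the cell sits at base levels, which a star cell never takes; agreement thus forces D ⊆ E.
-/
theorem StarCell.agrees_toCell_iff {D E : Finset V} (i : StarCell b E) (k : StarCell b D) :
    (∀ γ : D, i.toCell γ = k.1 γ) ↔ ∃ h : D ⊆ E, k = i.restrict h := by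
  constructor
  · intro H
    have hDE : D ⊆ E := fun γ hγ => (i.mem_iff_toCell_ne γ).2 (by
      rw [H ⟨γ, hγ⟩]
      exact k.2 ⟨γ, hγ⟩)
    refine ⟨hDE, Subtype.ext (funext fun γ => ?_)⟩
    rw [← H γ, i.toCell_of_mem (hDE γ.2)]
    rfl
  · rintro ⟨h, rfl⟩ γ
    exact i.toCell_of_mem (h γ.2)

/-- Every cell is `i(E)` for exactly one `E` and one `i_E`. -/
theorem bijective_toCell [Fintype V] [∀ γ, DecidableEq (I γ)] :
    Function.Bijective fun x : Σ E : Finset V, StarCell b E => x.2.toCell := by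
  constructor
  · rintro ⟨E, i⟩ ⟨E', i'⟩ h
    have h' : i.toCell = i'.toCell := h
    obtain rfl : E = E' := by
      ext γ
      rw [i.mem_iff_toCell_ne, i'.mem_iff_toCell_ne, h']
    congr 1
    refine Subtype.ext (funext fun γ => ?_)
    rw [← i.toCell_of_mem γ.2, ← i'.toCell_of_mem γ.2, h']
  · intro j
    refine ⟨⟨Finset.univ.filter fun γ => j γ ≠ b γ,
      ⟨fun γ => j γ, fun γ => (Finset.mem_filter.1 γ.2).2⟩⟩, funext fun γ => ?_⟩
    by_cases h : γ ∈ Finset.univ.filter fun γ => j γ ≠ b γ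
    · exact StarCell.toCell_of_mem _ h
    · refine (StarCell.toCell_of_notMem _ h).trans ?_
      simpa [eq_comm] using h

end Cells

/-! ### Linear predictors and log-linear parameters -/

variable {V : Type*} [Fintype V] [DecidableEq V] {I : V → Type*} {b : ∀ γ, I γ}
  {𝒟 : Finset (Finset V)}

/-- The summand `θ(i_F)` of the predictor, extended by zero. -/
def predictorTerm (θ : Index b 𝒟 → ℝ) {E : Finset V} (i : StarCell b E) (F : Finset V) : ℝ :=
  if h : F ∈ 𝒟 ∧ F ⊆ E then θ ⟨⟨F, h.1⟩, i.restrict h.2⟩ else 0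

theorem predictor_eq_sum_univ (θ : Index b 𝒟 → ℝ) {E : Finset V} (i : StarCell b E) :
    predictor θ i = ∑ F, predictorTerm θ i F := by
  have hsupp : ∑ F, predictorTerm θ i F =
      ∑ F ∈ Finset.univ.filter (fun F => F ∈ 𝒟 ∧ F ⊆ E), predictorTerm θ i F := by
    refine (Finset.sum_subset (Finset.filter_subset _ _) fun F _ hF => ?_).symm
    exact dif_neg (by simpa using hF)
  rw [hsupp, Finset.sum_subtype _ (p := fun F => F ∈ 𝒟 ∧ F ⊆ E) (by simp)]
  exact Finset.sum_congr rfl fun F _ => by rw [predictorTerm, dif_pos F.2]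

/-- Writes all predictors below E as lower-set sums of one function, the form Möbius inversion
needs. -/
theorem predictor_restrict (θ : Index b 𝒟 → ℝ) {E F : Finset V} (i : StarCell b E) (h : F ⊆ E) :
    predictor θ (i.restrict h) = ∑ G ∈ F.powerset, predictorTerm θ i G := by
  rw [predictor_eq_sum_univ, ← Finset.sum_subset (Finset.subset_univ F.powerset)]
  · refine Finset.sum_congr rfl fun G hG => ?_
    have hGF := Finset.mem_powerset.1 hG
    by_cases hG𝒟 : G ∈ 𝒟
    · rw [predictorTerm, predictorTerm, dif_pos ⟨hG𝒟, hGF⟩, dif_pos ⟨hG𝒟, hGF.trans h⟩]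
      rfl
    · rw [predictorTerm, predictorTerm, dif_neg fun H => hG𝒟 H.1, dif_neg fun H => hG𝒟 H.1]
  · intro G _ hG
    exact dif_neg fun H => hG (Finset.mem_powerset.2 H.2)

/-- The log-linear parameters are recovered from the predictors by Möbius inversion. -/
theorem sum_neg_one_pow_mul_predictor (θ : Index b 𝒟 → ℝ) {E : Finset V} (i : StarCell b E) :
    ∑ F : {F : Finset V // F ⊆ E}, (-1) ^ (E \ F.1).card * predictor θ (i.restrict F.2) =
      predictorTerm θ i E := by
  rw [← Finset.sum_powerset_neg_one_pow_mul_sum_powerset (predictorTerm θ i) E,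
    Finset.sum_subtype E.powerset (p := fun F => F ⊆ E) (by simp)]
  exact Finset.sum_congr rfl fun F _ => by rw [predictor_restrict]

/-- Inverting log p = predictor - log Z leaves the θ-term at E, zero since E ∉ 𝒟; the constant
cancels because E is nonempty. -/
theorem logLinearParam_of_eq_exp_predictor_div (p : (∀ γ, I γ) → ℝ) (θ : Index b 𝒟 → ℝ) {Z : ℝ}
    (hZ : Z ≠ 0)
    (hp : ∀ (E : Finset V) (i : StarCell b E), p i.toCell = Real.exp (predictor θ i) / Z)
    {E : Finset V} (hE : E.Nonempty) (hE𝒟 : E ∉ 𝒟) (i : StarCell b E) :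
    logLinearParam p i = 0 := by
  have hconst : ∑ F : {F : Finset V // F ⊆ E}, (-1 : ℝ) ^ (E \ F.1).card = 0 := by
    -- The constant 1 is the lower-set sum of the indicator of ∅.
    have h := Finset.sum_powerset_neg_one_pow_mul_sum_powerset
      (fun G : Finset V => if G = ∅ then (1 : ℝ) else 0) E
    rw [if_neg hE.ne_empty, Finset.sum_subtype E.powerset (p := fun F => F ⊆ E) (by simp)] at h
    simpa using h
  have hlog : ∀ F : {F : Finset V // F ⊆ E},
      Real.log (p (i.restrict F.2).toCell) = predictor θ (i.restrict F.2) - Real.log Z := by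
    intro F
    rw [hp, Real.log_div (Real.exp_pos _).ne' hZ, Real.log_exp]
  simp only [logLinearParam, hlog, mul_sub, Finset.sum_sub_distrib]
  rw [sum_neg_one_pow_mul_predictor, ← Finset.sum_mul, hconst, zero_mul, sub_zero]
  exact dif_neg fun H => hE𝒟 H.1

variable [∀ γ, DecidableEq (I γ)] [∀ γ, Fintype (I γ)]

theorem marginal_eq_sum_agreement (p : (∀ γ, I γ) → ℝ) (x : Index b 𝒟) :
    marginal p x.2 = ∑ j, p j * agreement j x := by
  simp only [marginal, agreement, mul_ite, mul_one, mul_zero, Finset.sum_filter]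

/-- The bridge to the exponential family: agreement selects exactly the terms with F ⊆ E. -/
theorem predictor_eq_sum_agreement (θ : Index b 𝒟 → ℝ) {E : Finset V} (i : StarCell b E) :
    predictor θ i = ∑ x, θ x * agreement i.toCell x := by
  rw [Fintype.sum_sigma, predictor_eq_sum_univ,
    ← Finset.sum_subset (Finset.subset_univ 𝒟)
      (fun F _ hF => dif_neg fun H => hF H.1),
    Finset.sum_subtype 𝒟 (p := fun F => F ∈ 𝒟) (fun _ => Iff.rfl)]
  refine Finset.sum_congr rfl fun D _ => ?_
  simp only [agreement, StarCell.agrees_toCell_iff, mul_ite, mul_one, mul_zero]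
  by_cases h : D.1 ⊆ E
  · simp [predictorTerm, D.2, h]
  · simp [predictorTerm, h]

theorem sum_cells_eq (f : (∀ γ, I γ) → ℝ) :
    ∑ j, f j = f b + ∑ E : {E : Finset V // E.Nonempty}, ∑ i : StarCell b E.1, f i.toCell := by
  rw [← (bijective_toCell (b := b)).sum_comp f, Fintype.sum_sigma,
    ← Finset.add_sum_erase _ _ (Finset.mem_univ (∅ : Finset V)),
    Finset.sum_subtype (Finset.univ.erase (∅ : Finset V)) (p := Finset.Nonempty)
      (by simp [Finset.nonempty_iff_ne_empty])]
  congr 1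
  have hcell : ∀ i : StarCell b (∅ : Finset V), i.toCell = b := fun i =>
    funext fun γ => i.toCell_of_notMem (Finset.notMem_empty γ)
  have : Unique (StarCell b (∅ : Finset V)) :=
    { default := ⟨fun γ => absurd γ.2 (Finset.notMem_empty _),
        fun γ => absurd γ.2 (Finset.notMem_empty _)⟩
      uniq := fun i => Subtype.ext (funext fun γ => absurd γ.2 (Finset.notMem_empty _)) }
  simp [hcell]

theorem partitionFn_eq_sum (h𝒟 : ∅ ∉ 𝒟) (θ : Index b 𝒟 → ℝ) :
    partitionFn θ = ∑ j, Real.exp (∑ x, θ x * agreement j x) := by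
  rw [sum_cells_eq (b := b)]
  simp [partitionFn, predictor_eq_sum_agreement, agreement_base h𝒟]

/-- Each parameter is a linear combination of the linear predictors of the cells. -/
theorem exists_coord_eq_sum_predictor (x : Index b 𝒟) :
    ∃ c : (∀ γ, I γ) → ℝ, ∀ θ : Index b 𝒟 → ℝ,
      θ x = ∑ j, c j * ∑ y, θ y * agreement j y := by
  -- The coefficients are the Möbius signs, placed at the cells of the restrictions of i_D.
  refine ⟨fun j => ∑ F : {F : Finset V // F ⊆ x.1.1},
    if j = (x.2.restrict F.2).toCell then (-1) ^ (x.1.1 \ F.1).card else 0, fun θ => ?_⟩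
  have h := sum_neg_one_pow_mul_predictor θ x.2
  rw [predictorTerm, dif_pos ⟨x.1.2, Finset.Subset.refl _⟩] at h
  refine h.symm.trans ?_
  simp only [Finset.sum_mul]
  rw [Finset.sum_comm]
  simp [predictor_eq_sum_agreement]

/-! ### The implications between the three conditions -/

theorem normConst_eq (h𝒟 : ∅ ∉ 𝒟) (s : Index b 𝒟 → ℝ) (α : ℝ) :
    normConst s α = ∫⁻ θ : Index b 𝒟 → ℝ, ENNReal.ofReal (Real.exp (∑ x, θ x * s x -
      α * Real.log (∑ j, Real.exp (∑ x, θ x * agreement j x)))) := by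
  simp only [normConst, priorKernel, partitionFn_eq_sum h𝒟]

theorem empty_notMem_interactions (A : Finset (Finset V)) : ∅ ∉ interactions A := by
  simp [interactions]

theorem IsProper.exists_mean_eq [Nonempty (Index b 𝒟)] (h𝒟 : ∅ ∉ 𝒟) {s : Index b 𝒟 → ℝ} {α : ℝ}
    (h : IsProper s α) :
    0 < α ∧ ∃ ρ : (∀ γ, I γ) → ℝ, (∀ j, 0 < ρ j) ∧ (∀ x, s x = α * marginal ρ x.2) ∧
      ∃ θ : Index b 𝒟 → ℝ, ∀ (E : Finset V) (i : StarCell b E),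
        ρ i.toCell = Real.exp (predictor θ i) / partitionFn θ := by
  rw [IsProper, normConst_eq h𝒟] at h
  obtain ⟨hα, θ, hθ⟩ := exists_mean_eq_of_lintegral_lt_top _ b (agreement_base h𝒟) s α h
  refine ⟨hα, fun j => Real.exp (∑ y, θ y * agreement j y) / partitionFn θ, fun j => ?_,
    fun x => ?_, θ, fun E i => ?_⟩
  · rw [partitionFn_eq_sum h𝒟]
    exact div_pos (Real.exp_pos _)
      (Finset.sum_pos (fun _ _ => Real.exp_pos _) ⟨b, Finset.mem_univ b⟩)
  · rw [marginal_eq_sum_agreement, hθ, partitionFn_eq_sum h𝒟]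
  · simp only [predictor_eq_sum_agreement]

theorem mem_hierarchicalModel_of_eq_exp_predictor_div (ρ : (∀ γ, I γ) → ℝ) (hρ : ∀ j, 0 < ρ j)
    (h𝒟 : ∅ ∉ 𝒟) (θ : Index b 𝒟 → ℝ) (hθ : ∀ (E : Finset V) (i : StarCell b E),
      ρ i.toCell = Real.exp (predictor θ i) / partitionFn θ) :
    ρ ∈ hierarchicalModel b 𝒟 := by
  have hZ : partitionFn θ ≠ 0 := by
    rw [partitionFn_eq_sum h𝒟]
    exact (Finset.sum_pos (fun _ _ => Real.exp_pos _) ⟨b, Finset.mem_univ b⟩).ne'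
  refine ⟨hρ, ?_, fun E hE hE𝒟 i => logLinearParam_of_eq_exp_predictor_div ρ θ hZ hθ hE hE𝒟 i⟩
  have hcell : ∀ j, ρ j = Real.exp (∑ y, θ y * agreement j y) / partitionFn θ := by
    intro j
    obtain ⟨⟨E, i⟩, rfl⟩ := (bijective_toCell (b := b)).surjective j
    exact (hθ E i).trans (by rw [predictor_eq_sum_agreement])
  simp only [hcell]
  rw [← Finset.sum_div, ← partitionFn_eq_sum h𝒟, div_self hZ]

theorem isProper_of_mem_marginalSpace (h𝒟 : ∅ ∉ 𝒟) {s : Index b 𝒟 → ℝ} {α : ℝ} (hα : 0 < α)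
    (h : (fun x => s x / α) ∈ marginalSpace b 𝒟) : IsProper s α := by
  obtain ⟨p, ⟨hp, hp1, -⟩, hm⟩ := h
  rw [IsProper, normConst_eq h𝒟]
  refine lintegral_lt_top_of_mean_eq _ b (agreement_base h𝒟) exists_coord_eq_sum_predictor s hα
    p hp hp1 fun x => ?_
  rw [← marginal_eq_sum_agreement, ← hm x, mul_div_cancel₀ _ hα.ne']

end LogLinear

theorem lemma3p1 {V : Type*} [Fintype V] [DecidableEq V] {I : V → Type*}
    [∀ γ, Fintype (I γ)] [∀ γ, DecidableEq (I γ)] (b : ∀ γ, I γ)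
    (A : Finset (Finset V))
    -- the model has at least one free parameter
    (hd : Nonempty (LogLinear.Index b (LogLinear.interactions A)))
    (s : LogLinear.Index b (LogLinear.interactions A) → ℝ) (α : ℝ) :
    (LogLinear.IsProper s α ↔
      0 < α ∧ (fun x => s x / α) ∈ LogLinear.marginalSpace b (LogLinear.interactions A)) ∧
    (LogLinear.IsProper s α ↔
      0 < α ∧ ∃ ρ : (∀ γ, I γ) → ℝ, (∀ j, 0 < ρ j) ∧
        (∀ x : LogLinear.Index b (LogLinear.interactions A),
          s x = α * LogLinear.marginal ρ x.2) ∧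
        ∃ θ : LogLinear.Index b (LogLinear.interactions A) → ℝ,
          ∀ (E : Finset V) (i : LogLinear.StarCell b E),
            ρ i.toCell = Real.exp (LogLinear.predictor θ i) / LogLinear.partitionFn θ) := by
  have h𝒟 := LogLinear.empty_notMem_interactions A
  have h13 := fun h : LogLinear.IsProper s α => h.exists_mean_eq h𝒟
  have h32 : (0 < α ∧ ∃ ρ : (∀ γ, I γ) → ℝ, (∀ j, 0 < ρ j) ∧
        (∀ x : LogLinear.Index b (LogLinear.interactions A),
          s x = α * LogLinear.marginal ρ x.2) ∧
        ∃ θ : LogLinear.Index b (LogLinear.interactions A) → ℝ,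
          ∀ (E : Finset V) (i : LogLinear.StarCell b E),
            ρ i.toCell = Real.exp (LogLinear.predictor θ i) / LogLinear.partitionFn θ) →
      0 < α ∧ (fun x => s x / α) ∈ LogLinear.marginalSpace b (LogLinear.interactions A) := by
    rintro ⟨hα, ρ, hρ, hs, θ, hθ⟩
    refine ⟨hα, ρ, LogLinear.mem_hierarchicalModel_of_eq_exp_predictor_div ρ hρ h𝒟 θ hθ,
      fun x => ?_⟩
    exact (congrArg (· / α) (hs x)).trans (mul_div_cancel_left₀ _ hα.ne')
  have h21 := fun h : 0 < α ∧
      (fun x => s x / α) ∈ LogLinear.marginalSpace b (LogLinear.interactions A) =>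
    LogLinear.isProper_of_mem_marginalSpace h𝒟 h.1 h.2
  exact ⟨⟨fun h => h32 (h13 h), h21⟩, ⟨h13, fun h => h21 (h32 h)⟩⟩
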